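/- **Theorem (Parseval's formula for the quadratic-phase Fourier–Bessel transform).** Let $a,b,c,d,e\in\mathbb{R}$ with $b\neq 0$, and let $\gamma\ge -1/2$. For $1\le p<\infty$ let $L^p_\gamma(\mathbb{R}_+)$ be the space of measurable $h:(0,\infty)\to\mathbb{C}$ with $\int_0^\infty |h(s)|^p s^{2\gamma+1}\,ds<\infty$ (functions equal almost everywhere being identified). Put $$j_\gamma(x)=\Gamma(\gamma+1)\sum_{n=0}^{\infty}\frac{(-1)^n (x/2)^{2n}}{n!\,\Gamma(n+\gamma+1)},\qquad c_\gamma=\frac{1}{2^\gamma\Gamma(\gamma+1)},$$ and, for $h\in L^1_\gamma(\mathbb{R}_+)$ and $t>0$, $$\mathbb{B}^{a,b,c}_{d,e,\gamma}[h](t)=\frac{c_\gamma}{(ib)^{\gamma+1}}\int_0^\infty e^{-i(as^2+ct^2+ds+et)}\,j_\gamma\!\left(\frac{st}{b}\right)h(s)\,s^{2\gamma+1}\,ds,$$ with the principal branch of the power $(ib)^{\gamma+1}$. Then $\mathbb{B}^{a,b,c}_{d,e,\gamma}$, restricted to $L^1_\gamma(\mathbb{R}_+)\cap L^2_\gamma(\mathbb{R}_+)$,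 extends in exactly one way to a bounded linear operator of $L^2_\gamma(\mathbb{R}_+)$ into itself. Denoting this extension again by $\mathbb{B}^{a,b,c}_{d,e,\gamma}$, for all $h,g\in L^2_\gamma(\mathbb{R}_+)$ we have $$\int_0^\infty h(s)\,\overline{g(s)}\,s^{2\gamma+1}\,ds=\int_0^\infty \mathbb{B}^{a,b,c}_{d,e,\gamma}[h](t)\,\overline{\mathbb{B}^{a,b,c}_{d,e,\gamma}[g](t)}\,t^{2\gamma+1}\,dt.$$ -/

import Mathlib

open MeasureTheory Set ComplexConjugate

noncomputable section

namespace QPFB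

/-- The normalized Bessel function `j_γ`, given by its (everywhere convergent) power series. -/
def besselj (γ s : ℝ) : ℝ :=
  Real.Gamma (γ + 1) *
    ∑' n : ℕ, (-1 : ℝ) ^ n * (s / 2) ^ (2 * n) / ((n.factorial : ℝ) * Real.Gamma (n + γ + 1))

/-- The constant `c_γ = 1 / (2 ^ γ Γ(γ + 1))`. -/
def cConst (γ : ℝ) : ℝ := 1 / ((2 : ℝ) ^ γ * Real.Gamma (γ + 1))

/-- The quadratic-phase Fourier–Bessel kernel
`e^{-i (a s² + c t² + d s + e t)} j_γ (s t / b)`. -/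
def kernel (a b c d e γ t s : ℝ) : ℂ :=
  Complex.exp (-Complex.I * ((a * s ^ 2 + c * t ^ 2 + d * s + e * t : ℝ) : ℂ)) *
    (besselj γ (s * t / b) : ℂ)

/-- The measure `s ^ (2 γ + 1) ds` on the half line `(0, ∞)`; the space `L^p_γ(ℝ₊)` is `L^p` of this
measure. -/
def weight (γ : ℝ) : Measure ℝ :=
  (volume.restrict (Ioi 0)).withDensity fun s => ENNReal.ofReal (s ^ (2 * γ + 1))

/-- The quadratic-phase Fourier–Bessel transform of an integrable function `h`, as an integral.
The power of `i b` is the principal one. -/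
def transform (a b c d e γ : ℝ) (h : ℝ → ℂ) (t : ℝ) : ℂ :=
  (cConst γ : ℂ) / (Complex.I * (b : ℂ)) ^ ((γ : ℂ) + 1) *
    ∫ s in Ioi (0 : ℝ), kernel a b c d e γ t s * h s * ((s ^ (2 * γ + 1) : ℝ) : ℂ)

/-- A bounded operator `T` on `L²_γ(ℝ₊)` extends the quadratic-phase Fourier–Bessel transform if it
is given by the integral on `L¹_γ(ℝ₊) ∩ L²_γ(ℝ₊)`. -/
def IsExtension (a b c d e γ : ℝ) (T : Lp ℂ 2 (weight γ) →L[ℂ] Lp ℂ 2 (weight γ)) : Prop :=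
  ∀ (h : ℝ → ℂ) (_ : MemLp h 1 (weight γ)) (h2 : MemLp h 2 (weight γ)),
    T (h2.toLp h) =ᵐ[weight γ] transform a b c d e γ h

open Classical in
/-- The quadratic-phase Fourier–Bessel transform on `L²_γ(ℝ₊)`: the bounded operator that extends
the integral transform on `L¹_γ(ℝ₊) ∩ L²_γ(ℝ₊)` (with value `0` if there were none). -/
def transformL2 (a b c d e γ : ℝ) : Lp ℂ 2 (weight γ) →L[ℂ] Lp ℂ 2 (weight γ) :=
  if H : ∃ T, IsExtension a b c d e γ T then H.choose else 0

end QPFB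

end

/-! The chirped Gaussians `e^{i(as²+ds)} e^{-xs²}`, `x > 0`, serve as test vectors. Their chirp
cancels the `s`-part of the kernel's phase, so the transform acts on them as a Hankel transform of a
Gaussian and returns a multiple of a chirped Gaussian in `t` (`transform_gaussChirp`). The two
families have the same Gram matrix (`inner_transform_gaussLp`) and the first is total
(`dense_span_gaussLp`), so one bounded operator `T` on L² carries one to the other, and it preserves
inner products: this is Parseval's formula. It remains to see that `T` is the integral on L¹ ∩ L².
Since `|j_γ| ≤ 1` (`abs_besselj_le_one`), Fubini gives a duality for the integral transform
(`integral_transform_mul`); hence `T h` and the integral have the same pairings with all chirped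
Gaussians, and these determine a function (`ae_eq_zero_of_integral_gaussian`). Uniqueness is density
again. -/

namespace QPFB

/-! ### The Bessel series and the bound `|j_γ| ≤ 1`. -/

/-- The entire function `∑ (-1) ^ n y ^ n / (n! Γ(n + γ + 1))`, in terms of which
`j_γ(x) = Γ(γ + 1) φ_γ(x ^ 2 / 4)`. -/
noncomputable def besselSeries (γ y : ℝ) : ℝ :=
  ∑' n : ℕ, (-1 : ℝ) ^ n * y ^ n / ((n.factorial : ℝ) * Real.Gamma (n + γ + 1))

theorem besselj_eq (γ s : ℝ) :
    besselj γ s = Real.Gamma (γ + 1) * besselSeries γ (s ^ 2 / 4) := by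
  unfold besselj besselSeries
  congr 1
  refine tsum_congr fun n => ?_
  rw [pow_mul, div_pow s 2 2]
  norm_num

theorem Gamma_pos_of_neg_half_le {γ : ℝ} (hγ : -1 / 2 ≤ γ) : 0 < Real.Gamma (γ + 1) :=
  Real.Gamma_pos_of_pos (by linarith)

theorem Gamma_nat_add_succ {γ : ℝ} (hγ : -1 / 2 ≤ γ) (n : ℕ) :
    Real.Gamma ((n + 1 : ℕ) + γ + 1) = (n + γ + 1) * Real.Gamma (n + γ + 1) := by
  rw [← Real.Gamma_add_one]
  · push_cast; ring_nf
  · have : (0 : ℝ) ≤ n := n.cast_nonneg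
    linarith

theorem Gamma_nat_add_pos {γ : ℝ} (hγ : -1 / 2 ≤ γ) (n : ℕ) : 0 < Real.Gamma (n + γ + 1) :=
  Real.Gamma_pos_of_pos (by have : (0 : ℝ) ≤ n := n.cast_nonneg; linarith)

/-- Each step of the recursion multiplies Gamma by `n + γ + 1 ≥ 1/2`. The crude bound suffices to
majorize the Bessel series by an exponential series. -/
theorem Gamma_le_two_pow_mul_Gamma {γ : ℝ} (hγ : -1 / 2 ≤ γ) (n : ℕ) :
    Real.Gamma (γ + 1) ≤ 2 ^ n * Real.Gamma (n + γ + 1) := by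
  induction n with
  | zero => simp
  | succ n ih =>
    refine ih.trans ?_
    rw [Gamma_nat_add_succ hγ, pow_succ]
    have h0 : (0 : ℝ) ≤ n := n.cast_nonneg
    have h1 := Gamma_nat_add_pos hγ n
    have h2 : (0 : ℝ) < 2 ^ n := by positivity
    have h3 := mul_pos h2 h1
    nlinarith

/-- The coefficients of `besselSeries`. -/
noncomputable def besselCoeff (γ : ℝ) (n : ℕ) : ℝ :=
  (-1 : ℝ) ^ n / ((n.factorial : ℝ) * Real.Gamma (n + γ + 1))

theorem besselSeries_eq (γ y : ℝ) : besselSeries γ y = ∑' n, besselCoeff γ n * y ^ n :=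
  tsum_congr fun n => by rw [besselCoeff]; ring

theorem abs_besselCoeff_mul_pow_le {γ : ℝ} (hγ : -1 / 2 ≤ γ) (n : ℕ) {y R : ℝ} (hy : |y| ≤ R) :
    |besselCoeff γ n * y ^ n| ≤ (Real.Gamma (γ + 1))⁻¹ * ((2 * R) ^ n / n.factorial) := by
  have h1 := Gamma_nat_add_pos hγ n
  have h2 := Gamma_pos_of_neg_half_le hγ
  have h3 := Gamma_le_two_pow_mul_Gamma hγ n
  have hR : 0 ≤ R := (abs_nonneg y).trans hy
  have hf : (0 : ℝ) < n.factorial := by positivity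
  have h4 : (Real.Gamma (n + γ + 1))⁻¹ ≤ (Real.Gamma (γ + 1))⁻¹ * 2 ^ n := by
    rw [inv_mul_eq_div, le_div_iff₀ h2, inv_mul_le_iff₀ h1, mul_comm]
    exact h3
  calc |besselCoeff γ n * y ^ n|
      = (n.factorial : ℝ)⁻¹ * (Real.Gamma (n + γ + 1))⁻¹ * |y| ^ n := by
        rw [besselCoeff, abs_mul, abs_div, abs_pow, abs_neg, abs_one, one_pow, abs_mul,
          abs_of_pos hf, abs_of_pos h1, abs_pow, one_div, mul_inv]
    _ ≤ (n.factorial : ℝ)⁻¹ * ((Real.Gamma (γ + 1))⁻¹ * 2 ^ n) * R ^ n := by gcongr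
    _ = _ := by rw [mul_pow]; ring

theorem summable_besselCoeff_mul_pow {γ : ℝ} (hγ : -1 / 2 ≤ γ) (y : ℝ) :
    Summable fun n => besselCoeff γ n * y ^ n :=
  .of_norm_bounded ((Real.summable_pow_div_factorial (2 * |y|)).mul_left (Real.Gamma (γ + 1))⁻¹)
    fun n => abs_besselCoeff_mul_pow_le hγ n le_rfl

theorem besselCoeff_succ (γ : ℝ) (n : ℕ) :
    (n + 1) * besselCoeff γ (n + 1) = -besselCoeff (γ + 1) n := by
  rw [besselCoeff, besselCoeff, Nat.factorial_succ]
  push_cast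
  rw [show (n : ℝ) + 1 + γ + 1 = n + (γ + 1) + 1 by ring, pow_succ]
  have : (n : ℝ) + 1 ≠ 0 := by positivity
  have hf : (n.factorial : ℝ) ≠ 0 := by positivity
  by_cases h : Real.Gamma (n + (γ + 1) + 1) = 0
  · simp [h]
  · field_simp

theorem hasDerivAt_besselSeries {γ : ℝ} (hγ : -1 / 2 ≤ γ) (y : ℝ) :
    HasDerivAt (besselSeries γ) (-besselSeries (γ + 1) y) y := by
  have hγ' : -1 / 2 ≤ γ + 1 := by linarith
  set R := |y| + 1
  have key : HasDerivAt (fun z => ∑' n, besselCoeff γ n * z ^ n)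
      (∑' n : ℕ, besselCoeff γ n * (n * y ^ (n - 1))) y := by
    refine hasDerivAt_tsum_of_isPreconnected (t := Metric.ball (0 : ℝ) R)
      -- The constant term has derivative zero; later terms are, up to sign, terms of the series for
      -- `γ + 1`.
      (u := fun n => if n = 0 then 0 else
        (Real.Gamma (γ + 1 + 1))⁻¹ * ((2 * R) ^ (n - 1) / (n - 1).factorial))
      ?_ Metric.isOpen_ball (convex_ball _ _).isPreconnected
      (fun n z _ => (hasDerivAt_pow n z).const_mul _) ?_ (y₀ := 0) ?_
      (summable_besselCoeff_mul_pow hγ 0) ?_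
    · rw [← summable_nat_add_iff 1]
      simpa using (Real.summable_pow_div_factorial (2 * R)).mul_left (Real.Gamma (γ + 1 + 1))⁻¹
    · intro n z hz
      rcases n with _ | n
      · simp
      · have hz' : |z| ≤ R := by simpa using (Metric.mem_ball.1 hz).le
        have := abs_besselCoeff_mul_pow_le hγ' n hz'
        simp only [Nat.add_eq_zero_iff, one_ne_zero, and_false, if_false, Nat.add_sub_cancel]
        refine le_trans (le_of_eq ?_) this
        rw [Real.norm_eq_abs, ← abs_neg (besselCoeff (γ + 1) n * _), ← neg_mul,
          ← besselCoeff_succ]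
        push_cast
        ring_nf
    · simp [R]; positivity
    · simp [R]
  have e1 : besselSeries γ = fun z => ∑' n, besselCoeff γ n * z ^ n :=
    funext (besselSeries_eq γ)
  have hs : Summable fun n : ℕ => besselCoeff γ n * (n * y ^ (n - 1)) := by
    rw [← summable_nat_add_iff 1]
    refine (summable_besselCoeff_mul_pow hγ' y).neg.congr fun n => ?_
    rw [← neg_mul, ← besselCoeff_succ]
    push_cast
    ring
  have e2 : ∑' n : ℕ, besselCoeff γ n * (n * y ^ (n - 1)) = -besselSeries (γ + 1) y := by
    rw [hs.tsum_eq_zero_add, besselSeries_eq, ← tsum_neg]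
    simp only [CharP.cast_eq_zero, zero_mul, mul_zero, zero_add]
    refine tsum_congr fun n => ?_
    rw [← neg_mul, ← besselCoeff_succ]
    push_cast
    ring
  rw [e1, ← e2]
  exact key

/-- The three-term Bessel recurrence, checked coefficientwise; it collapses the derivative of the
energy below. -/
theorem mul_besselSeries_add_two {γ : ℝ} (hγ : -1 / 2 ≤ γ) (y : ℝ) :
    y * besselSeries (γ + 1 + 1) y = (γ + 1) * besselSeries (γ + 1) y - besselSeries γ y := by
  have h1 := summable_besselCoeff_mul_pow (show -1 / 2 ≤ γ + 1 by linarith) y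
  have h2 := summable_besselCoeff_mul_pow (show -1 / 2 ≤ γ + 1 + 1 by linarith) y
  have h0 := summable_besselCoeff_mul_pow hγ y
  rw [besselSeries_eq, besselSeries_eq, besselSeries_eq, ← tsum_mul_left, ← tsum_mul_left,
    ← (h1.mul_left _).tsum_sub h0, ((h1.mul_left _).sub h0).tsum_eq_zero_add]
  have hc (n : ℕ) : (γ + 1) * besselCoeff (γ + 1) n - besselCoeff γ n
      = -n * besselCoeff (γ + 1) n := by
    have hg := Gamma_nat_add_succ hγ n
    have hp := (Gamma_nat_add_pos hγ n).ne'
    have hn : (n : ℝ) + γ + 1 ≠ 0 := by have : (0 : ℝ) ≤ n := n.cast_nonneg; linarith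
    have hf : (n.factorial : ℝ) ≠ 0 := by positivity
    push_cast at hg
    rw [besselCoeff, besselCoeff, show (n : ℝ) + (γ + 1) + 1 = n + 1 + γ + 1 by ring, hg]
    field_simp
    ring
  have hz := hc 0
  simp only [CharP.cast_eq_zero, neg_zero, zero_mul] at hz
  simp only [pow_zero, mul_one, hz, zero_add]
  refine tsum_congr fun n => ?_
  have := besselCoeff_succ (γ + 1) n
  have h3 := hc (n + 1)
  push_cast at h3
  linear_combination (-y ^ (n + 1)) * h3 + y ^ (n + 1) * this

theorem besselSeries_zero (γ : ℝ) : besselSeries γ 0 = (Real.Gamma (γ + 1))⁻¹ := by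
  rw [besselSeries_eq, tsum_eq_single 0 (fun n hn => by simp [hn])]
  simp [besselCoeff]

/-- The energy `φ_γ ^ 2 + y φ_{γ+1} ^ 2` is nonincreasing for `γ ≥ -1/2`. -/
theorem antitoneOn_bessel_energy {γ : ℝ} (hγ : -1 / 2 ≤ γ) :
    AntitoneOn (fun y => besselSeries γ y ^ 2 + y * besselSeries (γ + 1) y ^ 2) (Ici 0) := by
  have hd (y : ℝ) : HasDerivAt (fun y => besselSeries γ y ^ 2 + y * besselSeries (γ + 1) y ^ 2)
      (-(2 * γ + 1) * besselSeries (γ + 1) y ^ 2) y := by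
    have h0 := hasDerivAt_besselSeries hγ y
    have h1 := hasDerivAt_besselSeries (show -1 / 2 ≤ γ + 1 by linarith) y
    refine ((h0.pow 2).add ((hasDerivAt_id y).mul (h1.pow 2))).congr_deriv ?_
    have := mul_besselSeries_add_two hγ y
    simp only [Nat.cast_ofNat, id_eq, Nat.add_one_sub_one, pow_one, Pi.pow_apply]
    linear_combination (-2 * besselSeries (γ + 1) y) * this
  refine antitoneOn_of_deriv_nonpos (convex_Ici 0)
    (fun y _ => (hd y).continuousAt.continuousWithinAt)
    (fun y _ => (hd y).differentiableAt.differentiableWithinAt) fun y _ => ?_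
  rw [(hd y).deriv]
  -- The sign condition `2γ + 1 ≥ 0` is exactly the hypothesis on `γ`.
  exact mul_nonpos_of_nonpos_of_nonneg (by linarith) (sq_nonneg _)

/-- The energy at `s²/4` dominates the square of the series there and is at most its value at `0`,
which is `Γ(γ+1)⁻²`. -/
theorem abs_besselj_le_one {γ : ℝ} (hγ : -1 / 2 ≤ γ) (s : ℝ) : |besselj γ s| ≤ 1 := by
  have hG := Gamma_pos_of_neg_half_le hγ
  have hs : (0 : ℝ) ≤ s ^ 2 / 4 := by positivity
  have h := antitoneOn_bessel_energy hγ (mem_Ici.2 le_rfl) (mem_Ici.2 hs) hs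
  simp only [besselSeries_zero, zero_mul, add_zero] at h
  have h' : besselSeries γ (s ^ 2 / 4) ^ 2 ≤ (Real.Gamma (γ + 1))⁻¹ ^ 2 :=
    le_trans (le_add_of_nonneg_right (by positivity)) h
  rw [besselj_eq, abs_mul, abs_of_pos hG, ← le_div_iff₀' hG, one_div]
  exact abs_le_of_sq_le_sq h' (by positivity)

theorem continuous_besselj {γ : ℝ} (hγ : -1 / 2 ≤ γ) : Continuous (besselj γ) := by
  have h : Continuous (besselSeries γ) :=
    continuous_iff_continuousAt.2 fun y => (hasDerivAt_besselSeries hγ y).continuousAt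
  rw [funext (besselj_eq γ)]
  fun_prop

/-! ### Injectivity of the Gaussian transform. -/

open Filter Topology

/-- Uniqueness for Gaussian transforms on the half line. -/
theorem ae_eq_zero_of_integral_gaussian {μ : Measure ℝ} (hμ : ∀ᵐ s ∂μ, 0 < s) {u : ℝ → ℂ}
    (hu : ∀ x : ℝ, 0 < x → Integrable (fun s => u s * (Real.exp (-x * s ^ 2) : ℂ)) μ)
    (h0 : ∀ x : ℝ, 0 < x → ∫ s, u s * (Real.exp (-x * s ^ 2) : ℂ) ∂μ = 0) :
    u =ᵐ[μ] 0 := by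
  -- Splitting off one factor `e^{-s²}` makes `v` integrable, and `τ ^ n` with `τ = e^{-s²}` then
  -- corresponds to the parameter `x = n + 1 > 0`.
  set v : ℝ → ℂ := fun s => u s * (Real.exp (-1 * s ^ 2) : ℂ) with hv
  have hvi : Integrable v μ := hu 1 one_pos
  have hpoly (p : Polynomial ℝ) :
      Integrable (fun s => p.eval (Real.exp (-s ^ 2)) • v s) μ ∧
        ∫ s, p.eval (Real.exp (-s ^ 2)) • v s ∂μ = 0 := by
    induction p using Polynomial.induction_on' with
    | add p q hp hq =>
      simp only [Polynomial.eval_add, add_smul]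
      exact ⟨hp.1.add hq.1, by rw [integral_add hp.1 hq.1, hp.2, hq.2, add_zero]⟩
    | monomial n r =>
      have hn : (0 : ℝ) < n + 1 := by positivity
      have e : (fun s => (Polynomial.monomial n r).eval (Real.exp (-s ^ 2)) • v s) =
          fun s => r • (u s * (Real.exp (-(n + 1) * s ^ 2) : ℂ)) := by
        funext s
        have : Real.exp (-(n + 1) * s ^ 2) = Real.exp (-s ^ 2) ^ n * Real.exp (-1 * s ^ 2) := by
          rw [← Real.exp_nat_mul, ← Real.exp_add]
          ring_nf
        rw [this, hv, Polynomial.eval_monomial]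
        simp only [Complex.real_smul, Complex.ofReal_mul, Complex.ofReal_pow]
        ring
      rw [e]
      exact ⟨(hu _ hn).smul r, by rw [integral_smul, h0 _ hn, smul_zero]⟩
  have key : ∀ᵐ s ∂μ, s ∈ Ioi (0 : ℝ) → v s = 0 := by
    refine isOpen_Ioi.ae_eq_zero_of_integral_contDiff_smul_eq_zero
      (hvi.locallyIntegrable.locallyIntegrableOn _) ?_
    intro g hg hgc hgs
    have hg0 : g 0 = 0 := image_eq_zero_of_notMem_tsupport fun h => lt_irrefl (0 : ℝ) (hgs h)
    -- The test function in the variable `τ`. At `τ = 0` the convention `log 0 = 0` gives `f 0 = g 0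
    -- = 0`, which is also the limit because `g` has compact support; so Weierstrass approximation
    -- applies on `[0, 1]`.
    set f : ℝ → ℝ := fun τ => g (Real.sqrt (-Real.log τ)) with hf
    have hfc : ContinuousOn f (Icc 0 1) := by
      intro τ hτ
      rcases hτ.1.eq_or_lt with rfl | hpos
      · rw [continuousWithinAt_Icc_iff_Ici zero_lt_one, ← continuousWithinAt_Ioi_iff_Ici]
        have h1 : Tendsto (fun τ : ℝ => Real.sqrt (-Real.log τ)) (𝓝[>] 0) atTop :=
          Real.tendsto_sqrt_atTop.comp (tendsto_neg_atBot_atTop.comp Real.tendsto_log_nhdsGT_zero)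
        have h2 : Tendsto g atTop (𝓝 0) := hgc.is_zero_at_infty.mono_left atTop_le_cocompact
        have h3 : f 0 = 0 := by simp [hf, hg0]
        rw [ContinuousWithinAt, h3]
        exact h2.comp h1
      · refine ContinuousAt.continuousWithinAt ?_
        have := Real.continuousAt_log hpos.ne'
        exact hg.continuous.continuousAt.comp (Real.continuous_sqrt.continuousAt.comp this.neg)
    have hfg : ∀ᵐ s ∂μ, f (Real.exp (-s ^ 2)) = g s := by
      filter_upwards [hμ] with s hs
      simp [hf, Real.sqrt_sq hs.le]
    obtain ⟨C, hC⟩ := hgc.exists_bound_of_continuous hg.continuous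
    have hgi : Integrable (fun s => g s • v s) μ :=
      hvi.bdd_smul C hg.continuous.aestronglyMeasurable (.of_forall hC)
    have hsmall (ε : ℝ) (hε : 0 < ε) : ‖∫ s, g s • v s ∂μ‖ ≤ ε * ∫ s, ‖v s‖ ∂μ := by
      obtain ⟨p, hp⟩ := exists_polynomial_near_of_continuousOn 0 1 f hfc ε hε
      rw [← sub_zero (∫ s, g s • v s ∂μ), ← (hpoly p).2, ← integral_sub hgi (hpoly p).1,
        ← integral_const_mul]
      refine norm_integral_le_of_norm_le (hvi.norm.const_mul ε) ?_
      filter_upwards [hfg] with s hs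
      rw [← sub_smul, norm_smul, ← hs, norm_sub_rev]
      gcongr
      exact (hp _ ⟨(Real.exp_pos _).le, Real.exp_le_one_iff.2 (by nlinarith [sq_nonneg s])⟩).le
    have hlim : Tendsto (fun ε : ℝ => ε * ∫ s, ‖v s‖ ∂μ) (𝓝[>] 0) (𝓝 0) := by
      have : Tendsto (fun ε : ℝ => ε * ∫ s, ‖v s‖ ∂μ) (𝓝 0) (𝓝 (0 * ∫ s, ‖v s‖ ∂μ)) :=
        tendsto_id.mul_const _
      rw [zero_mul] at this
      exact this.mono_left nhdsWithin_le_nhds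
    exact norm_le_zero_iff.1 (ge_of_tendsto hlim (eventually_mem_nhdsWithin.mono hsmall))
  filter_upwards [key, hμ] with s hs hpos
  simpa [hv, Complex.exp_ne_zero] using hs hpos

/-! ### The weighted measure and its Gaussian moments. -/

instance (γ : ℝ) : SFinite (weight γ) := by
  unfold weight
  infer_instance

theorem measurable_weight_density (γ : ℝ) :
    Measurable fun s : ℝ => ENNReal.ofReal (s ^ (2 * γ + 1)) := by fun_prop

theorem ae_weight_pos (γ : ℝ) : ∀ᵐ s ∂weight γ, 0 < s :=
  (withDensity_absolutelyContinuous _ _).ae_le (ae_restrict_mem measurableSet_Ioi)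

theorem integral_weight {E : Type*} [NormedAddCommGroup E] [NormedSpace ℝ E] (γ : ℝ) (f : ℝ → E) :
    ∫ s, f s ∂weight γ = ∫ s in Ioi (0 : ℝ), s ^ (2 * γ + 1) • f s := by
  rw [weight, integral_withDensity_eq_integral_toReal_smul (measurable_weight_density γ)
    (.of_forall fun _ => ENNReal.ofReal_lt_top)]
  refine setIntegral_congr_fun measurableSet_Ioi fun s (hs : 0 < s) => ?_
  simp only [ENNReal.toReal_ofReal (Real.rpow_nonneg hs.le _)]

theorem integrable_weight_iff {E : Type*} [NormedAddCommGroup E] [NormedSpace ℝ E] (γ : ℝ)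
    (f : ℝ → E) :
    Integrable f (weight γ) ↔ IntegrableOn (fun s => s ^ (2 * γ + 1) • f s) (Ioi 0) := by
  rw [weight, integrable_withDensity_iff_integrable_smul' (measurable_weight_density γ)
    (.of_forall fun _ => ENNReal.ofReal_lt_top)]
  refine integrableOn_congr_fun (fun s (hs : 0 < s) => ?_) measurableSet_Ioi
  simp only [ENNReal.toReal_ofReal (Real.rpow_nonneg hs.le _)]

theorem integral_weight_complex (γ : ℝ) (f : ℝ → ℂ) :
    ∫ s, f s ∂weight γ = ∫ s in Ioi (0 : ℝ), f s * ((s ^ (2 * γ + 1) : ℝ) : ℂ) := by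
  rw [integral_weight]
  simp only [Complex.real_smul, mul_comm]

theorem rpow_weight_mul_moment (γ x : ℝ) (n : ℕ) {s : ℝ} (hs : 0 < s) :
    s ^ (2 * γ + 1) • (s ^ (2 * n) * Real.exp (-x * s ^ 2)) =
      s ^ (2 * γ + 1 + 2 * n) * Real.exp (-x * s ^ (2 : ℝ)) := by
  rw [Real.rpow_add hs (2 * γ + 1), smul_eq_mul, ← mul_assoc, Real.rpow_two]
  congr 2
  rw [← Real.rpow_natCast]
  push_cast
  rfl

theorem integrable_gaussian_moment {γ : ℝ} (hγ : -1 / 2 ≤ γ) {x : ℝ} (hx : 0 < x) (n : ℕ) :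
    Integrable (fun s => s ^ (2 * n) * Real.exp (-x * s ^ 2)) (weight γ) := by
  have hn : (0 : ℝ) ≤ n := n.cast_nonneg
  rw [integrable_weight_iff]
  exact (integrableOn_rpow_mul_exp_neg_mul_rpow (by linarith) two_pos hx).congr_fun
    (fun s hs => (rpow_weight_mul_moment γ x n hs).symm) measurableSet_Ioi

theorem integral_gaussian_moment {γ : ℝ} (hγ : -1 / 2 ≤ γ) {x : ℝ} (hx : 0 < x) (n : ℕ) :
    ∫ s, s ^ (2 * n) * Real.exp (-x * s ^ 2) ∂weight γ =
      x ^ (-(γ + 1)) * (x⁻¹ ^ n * (1 / 2 * Real.Gamma (n + γ + 1))) := by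
  have hn : (0 : ℝ) ≤ n := n.cast_nonneg
  rw [integral_weight, setIntegral_congr_fun measurableSet_Ioi
    (fun s hs => rpow_weight_mul_moment γ x n hs),
    integral_rpow_mul_exp_neg_mul_rpow two_pos (by linarith) hx,
    show -(2 * γ + 1 + 2 * n + 1) / 2 = -(γ + 1) + -n by ring,
    show (2 * γ + 1 + 2 * n + 1) / 2 = n + γ + 1 by ring, Real.rpow_add hx, Real.rpow_neg hx.le n,
    Real.rpow_natCast, inv_pow]
  ring

theorem integrable_gaussian {γ : ℝ} (hγ : -1 / 2 ≤ γ) {x : ℝ} (hx : 0 < x) :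
    Integrable (fun s => Real.exp (-x * s ^ 2)) (weight γ) := by
  simpa using integrable_gaussian_moment hγ hx 0

theorem integral_gaussian_weight {γ : ℝ} (hγ : -1 / 2 ≤ γ) {x : ℝ} (hx : 0 < x) :
    ∫ s, Real.exp (-x * s ^ 2) ∂weight γ = x ^ (-(γ + 1)) * (1 / 2 * Real.Gamma (γ + 1)) := by
  simpa using integral_gaussian_moment hγ hx 0

/-! ### The Hankel transform of a Gaussian, term by term. -/

/-- The Hankel transform of a Gaussian. -/
theorem integral_besselj_mul_gaussian {γ : ℝ} (hγ : -1 / 2 ≤ γ) {x : ℝ} (hx : 0 < x) (t : ℝ) :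
    ∫ s, besselj γ (s * t) * Real.exp (-x * s ^ 2) ∂weight γ =
      Real.Gamma (γ + 1) / 2 * x ^ (-(γ + 1)) * Real.exp (-(4 * x)⁻¹ * t ^ 2) := by
  set C := Real.Gamma (γ + 1)
  let F (n : ℕ) (s : ℝ) : ℝ :=
    C * besselCoeff γ n * (t ^ 2 / 4) ^ n * (s ^ (2 * n) * Real.exp (-x * s ^ 2))
  have hF (n : ℕ) : Integrable (F n) (weight γ) := (integrable_gaussian_moment hγ hx n).const_mul _
  have hΓ (n : ℕ) := (Gamma_nat_add_pos hγ n).ne'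
  have hint (n : ℕ) : ∫ s, F n s ∂weight γ =
      C / 2 * x ^ (-(γ + 1)) * ((-(4 * x)⁻¹ * t ^ 2) ^ n / n.factorial) := by
    rw [integral_const_mul, integral_gaussian_moment hγ hx, besselCoeff,
      show -(4 * x)⁻¹ * t ^ 2 = (-1) * (t ^ 2 / 4) * x⁻¹ by rw [mul_inv]; ring, mul_pow, mul_pow]
    have := hΓ n
    have hf : (n.factorial : ℝ) ≠ 0 := by positivity
    field_simp
  have hnorm (n : ℕ) : ∫ s, ‖F n s‖ ∂weight γ =
      |C / 2 * x ^ (-(γ + 1))| * (((4 * x)⁻¹ * t ^ 2) ^ n / n.factorial) := by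
    have e (s : ℝ) : ‖F n s‖ = |C * besselCoeff γ n * (t ^ 2 / 4) ^ n| *
        (s ^ (2 * n) * Real.exp (-x * s ^ 2)) := by
      rw [norm_mul, Real.norm_eq_abs, Real.norm_of_nonneg
        (mul_nonneg ((even_two_mul n).pow_nonneg s) (Real.exp_pos _).le)]
    -- The moment is nonnegative, so the integral of the norm is the absolute value of the integral
    -- already found.
    have h := hint n
    rw [integral_const_mul] at h
    have hpos : 0 ≤ ∫ s, s ^ (2 * n) * Real.exp (-x * s ^ 2) ∂weight γ :=
      integral_nonneg fun s => mul_nonneg ((even_two_mul n).pow_nonneg s) (Real.exp_pos _).le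
    simp only [e]
    rw [integral_const_mul, ← abs_of_nonneg hpos, ← abs_mul, h, abs_mul, abs_div, abs_pow,
      abs_mul (-(4 * x)⁻¹), abs_neg, abs_of_nonneg (sq_nonneg t), abs_of_pos (show 0 < (4 * x)⁻¹ by positivity),
      Nat.abs_cast]
  have hs : Summable fun n => ∫ s, ‖F n s‖ ∂weight γ := by
    simp only [hnorm]
    exact (Real.summable_pow_div_factorial _).mul_left _
  have hsum := (hasSum_integral_of_summable_integral_norm hF hs).tsum_eq
  simp only [hint] at hsum
  rw [tsum_mul_left, ← congrFun NormedSpace.exp_eq_tsum_div, ← congrFun Real.exp_eq_exp_ℝ] at hsum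
  rw [hsum]
  refine integral_congr_ae (.of_forall fun s => ?_)
  simp only [F]
  rw [besselj_eq, besselSeries_eq, mul_assoc, ← tsum_mul_right, ← tsum_mul_left]
  refine tsum_congr fun n => ?_
  rw [show (s * t) ^ 2 / 4 = s ^ 2 * (t ^ 2 / 4) by ring, mul_pow, ← pow_mul]
  ring

/-! ### Extension from a total family. -/

/-- Two families with the same Gram matrix, the first one total, are related by an operator that
preserves inner products. -/
theorem exists_inner_preserving_extension {ι E F : Type*} [NormedAddCommGroup E]
    [InnerProductSpace ℂ E] [NormedAddCommGroup F] [InnerProductSpace ℂ F] [CompleteSpace F]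
    (v : ι → E) (w : ι → F) (hv : Dense (Submodule.span ℂ (range v) : Set E))
    (h : ∀ i j, inner ℂ (w i) (w j) = inner ℂ (v i) (v j)) :
    ∃ U : E →L[ℂ] F, (∀ i, U (v i) = w i) ∧ ∀ x y, inner ℂ (U x) (U y) = inner ℂ x y := by
  set e := Finsupp.linearCombination ℂ v
  set f := Finsupp.linearCombination ℂ w
  have hi (x y : ι →₀ ℂ) : inner ℂ (f x) (f y) = inner ℂ (e x) (e y) := by
    simp only [e, f, Finsupp.linearCombination_apply, Finsupp.sum_inner, Finsupp.inner_sum,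
      inner_smul_left, inner_smul_right, h]
  -- Equality of norms makes `f` vanish wherever `e` does, so `f` descends to the span of `v`.
  have hn (x : ι →₀ ℂ) : ‖f x‖ ≤ 1 * ‖e x‖ := by
    rw [one_mul, @norm_eq_sqrt_re_inner ℂ, @norm_eq_sqrt_re_inner ℂ, hi]
  have hd : DenseRange e := by
    rw [DenseRange, ← LinearMap.coe_range, Finsupp.range_linearCombination]
    exact hv
  have hU (x : ι →₀ ℂ) : f.extendOfNorm e (e x) = f x := LinearMap.extendOfNorm_eq hd ⟨1, hn⟩ x
  refine ⟨f.extendOfNorm e, fun i => ?_, fun x y => ?_⟩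
  · simpa [e, f] using hU (Finsupp.single i 1)
  · refine hd.induction_on₂ (p := fun x y =>
      inner ℂ (f.extendOfNorm e x) (f.extendOfNorm e y) = inner ℂ x y) ?_ ?_ x y
    · exact isClosed_eq (by fun_prop) (by fun_prop)
    · intro x y
      rw [hU, hU, hi]

/-! ### Chirped Gaussians in L². -/

/-- The chirped Gaussian `e^{-i (p s² + q s)} e^{-x s²}`. -/
noncomputable def gaussChirp (p q x s : ℝ) : ℂ :=
  Complex.exp (-Complex.I * ((p * s ^ 2 + q * s : ℝ) : ℂ)) * (Real.exp (-x * s ^ 2) : ℂ)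

theorem continuous_gaussChirp (p q x : ℝ) : Continuous (gaussChirp p q x) := by
  unfold gaussChirp
  fun_prop

theorem norm_exp_neg_I_mul (r : ℝ) : ‖Complex.exp (-Complex.I * (r : ℂ))‖ = 1 := by
  simp [Complex.norm_exp]

theorem norm_gaussChirp (p q x s : ℝ) : ‖gaussChirp p q x s‖ = Real.exp (-x * s ^ 2) := by
  rw [gaussChirp, norm_mul, norm_exp_neg_I_mul, one_mul, Complex.norm_real,
    Real.norm_of_nonneg (Real.exp_pos _).le]

theorem conj_gaussChirp (p q x s : ℝ) : conj (gaussChirp p q x s) = gaussChirp (-p) (-q) x s := by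
  rw [gaussChirp, gaussChirp, map_mul, ← Complex.exp_conj, Complex.conj_ofReal]
  simp only [map_mul, map_neg, Complex.conj_I, Complex.conj_ofReal]
  congr 2
  push_cast
  ring

theorem gaussChirp_mul (p q x p' q' y s : ℝ) :
    gaussChirp p q x s * gaussChirp p' q' y s = gaussChirp (p + p') (q + q') (x + y) s := by
  simp only [gaussChirp, Complex.ofReal_exp, ← Complex.exp_add]
  congr 1
  push_cast
  ring

theorem integrable_gaussChirp {γ : ℝ} (hγ : -1 / 2 ≤ γ) (p q : ℝ) {x : ℝ} (hx : 0 < x) :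
    Integrable (gaussChirp p q x) (weight γ) :=
  (integrable_gaussian hγ hx).mono' (continuous_gaussChirp p q x).aestronglyMeasurable
    (.of_forall fun s => (norm_gaussChirp p q x s).le)

theorem memLp_gaussChirp {γ : ℝ} (hγ : -1 / 2 ≤ γ) (p q : ℝ) {x : ℝ} (hx : 0 < x) :
    MemLp (gaussChirp p q x) 2 (weight γ) := by
  rw [memLp_two_iff_integrable_sq_norm (continuous_gaussChirp p q x).aestronglyMeasurable]
  refine (integrable_gaussian hγ (add_pos hx hx)).congr (.of_forall fun s => ?_)
  simp only [norm_gaussChirp]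
  rw [← Real.exp_nat_mul]
  push_cast
  ring_nf

/-- The chirped Gaussian as an element of `L²_γ(ℝ₊)`. -/
noncomputable def gaussLp {γ : ℝ} (hγ : -1 / 2 ≤ γ) (p q : ℝ) (x : Ioi (0 : ℝ)) :
    Lp ℂ 2 (weight γ) :=
  (memLp_gaussChirp hγ p q x.2).toLp _

theorem coeFn_gaussLp {γ : ℝ} (hγ : -1 / 2 ≤ γ) (p q : ℝ) (x : Ioi (0 : ℝ)) :
    gaussLp hγ p q x =ᵐ[weight γ] gaussChirp p q x :=
  MemLp.coeFn_toLp _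

theorem inner_gaussLp {γ : ℝ} (hγ : -1 / 2 ≤ γ) (p q : ℝ) (x : Ioi (0 : ℝ))
    (f : Lp ℂ 2 (weight γ)) :
    inner ℂ (gaussLp hγ p q x) f = ∫ s, f s * gaussChirp (-p) (-q) x s ∂weight γ := by
  rw [L2.inner_def]
  refine integral_congr_ae ?_
  filter_upwards [coeFn_gaussLp hγ p q x] with s hs
  rw [hs, ← conj_gaussChirp, RCLike.inner_apply]

theorem inner_gaussLp_gaussLp {γ : ℝ} (hγ : -1 / 2 ≤ γ) (p q : ℝ) (x y : Ioi (0 : ℝ)) :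
    inner ℂ (gaussLp hγ p q x) (gaussLp hγ p q y) =
      (((x + y : ℝ) ^ (-(γ + 1)) * (1 / 2 * Real.Gamma (γ + 1)) : ℝ) : ℂ) := by
  rw [inner_gaussLp, ← integral_gaussian_weight hγ (add_pos x.2 y.2), ← integral_complex_ofReal]
  refine integral_congr_ae ?_
  filter_upwards [coeFn_gaussLp hγ p q y] with s hs
  rw [hs, gaussChirp_mul, add_neg_cancel, add_neg_cancel, add_comm, gaussChirp]
  simp

theorem gaussChirp_eq_mul (p q x s : ℝ) :
    gaussChirp p q x s = gaussChirp p q 0 s * (Real.exp (-x * s ^ 2) : ℂ) := by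
  simp [gaussChirp]

/-- The chirp does not depend on `x` and never vanishes, so it can be absorbed into `u`. Only
integrability against Gaussians is asked, so `u` need not be in L². -/
theorem ae_eq_zero_of_integral_gaussChirp {γ : ℝ} (p q : ℝ) {u : ℝ → ℂ}
    (hu : ∀ x : ℝ, 0 < x → Integrable (fun s => u s * gaussChirp p q x s) (weight γ))
    (h0 : ∀ x : ℝ, 0 < x → ∫ s, u s * gaussChirp p q x s ∂weight γ = 0) :
    u =ᵐ[weight γ] 0 := by
  have e (x : ℝ) : (fun s => u s * gaussChirp p q x s) =
      fun s => u s * gaussChirp p q 0 s * (Real.exp (-x * s ^ 2) : ℂ) := by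
    funext s
    rw [gaussChirp_eq_mul, mul_assoc]
  simp only [e] at hu h0
  filter_upwards [ae_eq_zero_of_integral_gaussian (ae_weight_pos γ) hu h0] with s hs
  simpa [gaussChirp, Complex.exp_ne_zero] using hs

theorem integrable_mul_gaussChirp {γ : ℝ} (hγ : -1 / 2 ≤ γ) (p q : ℝ) {x : ℝ} (hx : 0 < x)
    (f : Lp ℂ 2 (weight γ)) : Integrable (fun s => f s * gaussChirp p q x s) (weight γ) :=
  (Lp.memLp f).integrable_mul (memLp_gaussChirp hγ p q hx)

theorem dense_span_gaussLp {γ : ℝ} (hγ : -1 / 2 ≤ γ) (p q : ℝ) :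
    Dense (Submodule.span ℂ (range (gaussLp hγ p q)) : Set (Lp ℂ 2 (weight γ))) := by
  rw [Submodule.dense_iff_topologicalClosure_eq_top, Submodule.topologicalClosure_eq_top_iff,
    Submodule.eq_bot_iff]
  intro f hf
  rw [Lp.eq_zero_iff_ae_eq_zero]
  refine ae_eq_zero_of_integral_gaussChirp (-p) (-q)
    (fun x hx => integrable_mul_gaussChirp hγ _ _ hx f) fun x hx => ?_
  rw [← inner_gaussLp hγ p q ⟨x, hx⟩]
  exact (Submodule.mem_orthogonal _ _).1 hf _ (Submodule.subset_span ⟨_, rfl⟩)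

/-! ### The integral transform and its duality. -/

theorem transform_eq_integral_weight (a b c d e γ : ℝ) (h : ℝ → ℂ) (t : ℝ) :
    transform a b c d e γ h t = (cConst γ : ℂ) / (Complex.I * (b : ℂ)) ^ ((γ : ℂ) + 1) *
      ∫ s, kernel a b c d e γ t s * h s ∂weight γ := by
  rw [transform, integral_weight_complex]

theorem kernel_swap (a b c d e γ t s : ℝ) : kernel a b c d e γ t s = kernel c b a e d γ s t := by
  rw [kernel, kernel, mul_comm s t]
  congr 4
  ring

theorem continuous_kernel {γ : ℝ} (hγ : -1 / 2 ≤ γ) (a b c d e : ℝ) :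
    Continuous fun z : ℝ × ℝ => kernel a b c d e γ z.1 z.2 := by
  have := continuous_besselj hγ
  unfold kernel
  fun_prop

theorem norm_kernel_le {γ : ℝ} (hγ : -1 / 2 ≤ γ) (a b c d e t s : ℝ) :
    ‖kernel a b c d e γ t s‖ ≤ 1 := by
  rw [kernel, norm_mul, norm_exp_neg_I_mul, one_mul, Complex.norm_real]
  exact abs_besselj_le_one hγ _

theorem stronglyMeasurable_kernel {γ : ℝ} (hγ : -1 / 2 ≤ γ) (a b c d e : ℝ) :
    StronglyMeasurable fun z : ℝ × ℝ => kernel a b c d e γ z.1 z.2 :=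
  (continuous_kernel hγ a b c d e).stronglyMeasurable

theorem aestronglyMeasurable_transform {γ : ℝ} (hγ : -1 / 2 ≤ γ) (a b c d e : ℝ) {h : ℝ → ℂ}
    (hh : Integrable h (weight γ)) :
    AEStronglyMeasurable (transform a b c d e γ h) (weight γ) := by
  rw [funext (transform_eq_integral_weight a b c d e γ h)]
  refine AEStronglyMeasurable.const_mul ?_ _
  refine AEStronglyMeasurable.integral_prod_right' (f := fun z : ℝ × ℝ =>
    kernel a b c d e γ z.1 z.2 * h z.2) ?_
  exact (stronglyMeasurable_kernel hγ a b c d e).aestronglyMeasurable.mul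
    hh.aestronglyMeasurable.comp_snd

theorem norm_transform_le {γ : ℝ} (hγ : -1 / 2 ≤ γ) (a b c d e : ℝ) {h : ℝ → ℂ}
    (hh : Integrable h (weight γ)) (t : ℝ) :
    ‖transform a b c d e γ h t‖ ≤
      ‖(cConst γ : ℂ) / (Complex.I * (b : ℂ)) ^ ((γ : ℂ) + 1)‖ * ∫ s, ‖h s‖ ∂weight γ := by
  rw [transform_eq_integral_weight, norm_mul]
  gcongr
  refine norm_integral_le_of_norm_le hh.norm (.of_forall fun s => ?_)
  rw [norm_mul]
  exact mul_le_of_le_one_left (norm_nonneg _) (norm_kernel_le hγ ..)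

/-- Duality of the transform with the one whose two chirps are interchanged. -/
theorem integral_transform_mul {γ : ℝ} (hγ : -1 / 2 ≤ γ) (a b c d e : ℝ) {h k : ℝ → ℂ}
    (hh : Integrable h (weight γ)) (hk : Integrable k (weight γ)) :
    ∫ t, transform a b c d e γ h t * k t ∂weight γ =
      ∫ s, h s * transform c b a e d γ k s ∂weight γ := by
  -- The kernel is bounded by `1`, so `|k(t)| |h(s)|` dominates and Fubini applies.
  have hint : Integrable (Function.uncurry fun t s => kernel a b c d e γ t s * (k t * h s))
      ((weight γ).prod (weight γ)) :=
    (hk.mul_prod hh).bdd_mul (stronglyMeasurable_kernel hγ a b c d e).aestronglyMeasurable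
      (.of_forall fun z => norm_kernel_le hγ a b c d e z.1 z.2)
  have hswap := integral_integral_swap hint
  set C := (cConst γ : ℂ) / (Complex.I * (b : ℂ)) ^ ((γ : ℂ) + 1) with hC
  calc ∫ t, transform a b c d e γ h t * k t ∂weight γ
      = ∫ t, C * ∫ s, kernel a b c d e γ t s * (k t * h s) ∂weight γ ∂weight γ := by
        congr 1 with t
        rw [transform_eq_integral_weight, mul_assoc, ← integral_mul_const, ← hC]
        congr 2 with s
        ring
    _ = ∫ s, C * ∫ t, kernel a b c d e γ t s * (k t * h s) ∂weight γ ∂weight γ := by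
        rw [integral_const_mul, hswap, integral_const_mul]
    _ = _ := by
        congr 1 with s
        rw [transform_eq_integral_weight, mul_left_comm, ← integral_const_mul (h s), ← hC]
        congr 2 with t
        rw [← kernel_swap]
        ring

/-! ### The transform on chirped Gaussians. -/

/-- The factor by which the transform of a chirped Gaussian differs from a chirped Gaussian. -/
noncomputable def gaussFactor (b γ x : ℝ) : ℂ :=
  (cConst γ : ℂ) / (Complex.I * (b : ℂ)) ^ ((γ : ℂ) + 1) *
    ((Real.Gamma (γ + 1) / 2 * x ^ (-(γ + 1)) : ℝ) : ℂ)

theorem transform_gaussChirp {γ : ℝ} (hγ : -1 / 2 ≤ γ) (a b c d e : ℝ) {x : ℝ} (hx : 0 < x)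
    (t : ℝ) :
    transform a b c d e γ (gaussChirp (-a) (-d) x) t =
      gaussFactor b γ x * gaussChirp c e (4 * x * b ^ 2)⁻¹ t := by
  have e1 (s : ℝ) : kernel a b c d e γ t s * gaussChirp (-a) (-d) x s =
      Complex.exp (-Complex.I * ((c * t ^ 2 + e * t : ℝ) : ℂ)) *
        ((besselj γ (s * (t / b)) * Real.exp (-x * s ^ 2) : ℝ) : ℂ) := by
    have : Complex.exp (-Complex.I * ((a * s ^ 2 + c * t ^ 2 + d * s + e * t : ℝ) : ℂ)) *
        Complex.exp (-Complex.I * ((-a * s ^ 2 + -d * s : ℝ) : ℂ)) =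
        Complex.exp (-Complex.I * ((c * t ^ 2 + e * t : ℝ) : ℂ)) := by
      rw [← Complex.exp_add]
      congr 1
      push_cast
      ring
    rw [kernel, gaussChirp, ← this, mul_div_assoc, Complex.ofReal_mul]
    ring
  rw [transform_eq_integral_weight]
  simp only [e1]
  rw [integral_const_mul, integral_complex_ofReal, integral_besselj_mul_gaussian hγ hx, gaussFactor,
    gaussChirp, show -(4 * x)⁻¹ * (t / b) ^ 2 = -(4 * x * b ^ 2)⁻¹ * t ^ 2 by
      rw [mul_inv (4 * x), div_pow]; ring, Complex.ofReal_mul]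
  ring

/-- The exponent is real, so the argument of `ib` affects only the phase. -/
theorem norm_I_mul_cpow {b : ℝ} (hb : b ≠ 0) (γ : ℝ) :
    ‖(Complex.I * (b : ℂ)) ^ ((γ : ℂ) + 1)‖ = |b| ^ (γ + 1) := by
  have h : Complex.I * (b : ℂ) ≠ 0 := mul_ne_zero Complex.I_ne_zero (Complex.ofReal_ne_zero.2 hb)
  rw [show (γ : ℂ) + 1 = ((γ + 1 : ℝ) : ℂ) by push_cast; rfl, Complex.norm_cpow_of_ne_zero h]
  simp

theorem norm_gaussFactor {b γ x : ℝ} (hb : b ≠ 0) (hγ : -1 / 2 ≤ γ) (hx : 0 < x) :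
    ‖gaussFactor b γ x‖ = (2 * |b| * x) ^ (-(γ + 1)) := by
  have hG := Gamma_pos_of_neg_half_le hγ
  have hb' := abs_pos.2 hb
  have h2 : (0 : ℝ) < 2 ^ γ := Real.rpow_pos_of_pos two_pos _
  rw [gaussFactor, norm_mul, norm_div, norm_I_mul_cpow hb, Complex.norm_real, Complex.norm_real,
    cConst, Real.norm_of_nonneg (show 0 ≤ 1 / (2 ^ γ * Real.Gamma (γ + 1)) by positivity),
    Real.norm_of_nonneg (by positivity),
    Real.mul_rpow (by positivity) hx.le, Real.mul_rpow two_pos.le hb'.le, Real.rpow_neg two_pos.le,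
    Real.rpow_neg hb'.le, Real.rpow_add_one two_ne_zero]
  field_simp

theorem conj_gaussFactor_mul {b γ x y : ℝ} (hb : b ≠ 0) (hγ : -1 / 2 ≤ γ) (hx : 0 < x)
    (hy : 0 < y) : conj (gaussFactor b γ x) * gaussFactor b γ y =
      (((4 * b ^ 2 * x * y) ^ (-(γ + 1)) : ℝ) : ℂ) := by
  have hb' := abs_pos.2 hb
  have e1 (z : ℝ) : gaussFactor b γ z = gaussFactor b γ 1 * ((z ^ (-(γ + 1)) : ℝ) : ℂ) := by
    simp only [gaussFactor, Real.one_rpow, mul_one]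
    push_cast
    ring
  rw [e1 x, e1 y, map_mul, Complex.conj_ofReal, mul_mul_mul_comm, mul_comm (conj _),
    Complex.mul_conj, Complex.normSq_eq_norm_sq, norm_gaussFactor hb hγ one_pos,
    ← Complex.ofReal_mul, ← Complex.ofReal_mul, mul_one, sq, ← Real.mul_rpow (by positivity)
    (by positivity), ← Real.mul_rpow hx.le hy.le, ← Real.mul_rpow (by positivity) (by positivity),
    show 2 * |b| * (2 * |b|) * (x * y) = 4 * (|b| ^ 2) * x * y by ring, sq_abs]

/-- The parameter of the Gaussian that the transform produces. -/
noncomputable def dualParam {b : ℝ} (hb : b ≠ 0) (x : Ioi (0 : ℝ)) : Ioi (0 : ℝ) :=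
  ⟨(4 * x * b ^ 2)⁻¹, by have : (0 : ℝ) < x := x.2; exact mem_Ioi.2 (by positivity)⟩

theorem inner_transform_gaussLp {b γ : ℝ} (hb : b ≠ 0) (hγ : -1 / 2 ≤ γ) (a c d e : ℝ)
    (x y : Ioi (0 : ℝ)) :
    inner ℂ (gaussFactor b γ x • gaussLp hγ c e (dualParam hb x))
      (gaussFactor b γ y • gaussLp hγ c e (dualParam hb y)) =
    inner ℂ (gaussLp hγ a d x) (gaussLp hγ a d y) := by
  have hx : (0 : ℝ) < x := x.2
  have hy : (0 : ℝ) < y := y.2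
  rw [inner_smul_left, inner_smul_right, ← mul_assoc, conj_gaussFactor_mul hb hγ hx hy,
    inner_gaussLp_gaussLp, inner_gaussLp_gaussLp, ← Complex.ofReal_mul, ← mul_assoc,
    ← Real.mul_rpow (by positivity) (by simp only [dualParam]; positivity)]
  -- What remains is `4b²xy (1/(4xb²) + 1/(4yb²)) = x + y`.
  congr 4
  simp only [dualParam]
  field_simp
  ring

/-! ### Existence, uniqueness and Parseval's formula. -/

theorem gaussLp_ext {γ : ℝ} (hγ : -1 / 2 ≤ γ) (p q : ℝ) {F : Type*} [NormedAddCommGroup F]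
    [NormedSpace ℂ F] {S T : Lp ℂ 2 (weight γ) →L[ℂ] F}
    (h : ∀ x, S (gaussLp hγ p q x) = T (gaussLp hγ p q x)) : S = T :=
  ContinuousLinearMap.ext_on (dense_span_gaussLp hγ p q) (by rintro _ ⟨x, rfl⟩; exact h x)

theorem isExtension_of_map_gaussLp {a b c d e γ : ℝ} (hb : b ≠ 0) (hγ : -1 / 2 ≤ γ)
    {T : Lp ℂ 2 (weight γ) →L[ℂ] Lp ℂ 2 (weight γ)}
    (hT : ∀ x, T (gaussLp hγ (-a) (-d) x) = gaussFactor b γ x • gaussLp hγ c e (dualParam hb x)) :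
    IsExtension a b c d e γ T := by
  have hTv (x : Ioi (0 : ℝ)) : T (gaussLp hγ (-a) (-d) x) =ᵐ[weight γ]
      transform a b c d e γ (gaussChirp (-a) (-d) x) := by
    rw [hT]
    filter_upwards [Lp.coeFn_smul (gaussFactor b γ x) (gaussLp hγ c e (dualParam hb x)),
      coeFn_gaussLp hγ c e (dualParam hb x)] with t h1 h2
    rw [h1, Pi.smul_apply, h2, smul_eq_mul, transform_gaussChirp hγ a b c d e x.2]
    rfl
  have hdual (x : Ioi (0 : ℝ)) (s : ℝ) : transform c b a e d γ (gaussChirp (-c) (-e) x) s =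
      gaussFactor b γ x * gaussChirp a d (dualParam hb x) s :=
    transform_gaussChirp hγ c b a e d x.2 s
  have hT' (x : Ioi (0 : ℝ)) (f : Lp ℂ 2 (weight γ)) :
      ∫ t, T f t * gaussChirp (-c) (-e) x t ∂weight γ =
        ∫ s, f s * transform c b a e d γ (gaussChirp (-c) (-e) x) s ∂weight γ := by
    -- For fixed `x` both sides of the duality are continuous functionals of `f`, so it is enough to
    -- compare them on Gaussians, where `T` is the integral and Fubini applies.
    have hST : innerSL ℂ (gaussLp hγ c e x) ∘L T =
        gaussFactor b γ x • innerSL ℂ (gaussLp hγ (-a) (-d) (dualParam hb x)) := by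
      refine gaussLp_ext hγ (-a) (-d) fun y => ?_
      simp only [ContinuousLinearMap.comp_apply, innerSL_apply_apply, smul_apply,
        inner_gaussLp, neg_neg, smul_eq_mul]
      have hy : ∫ t, T (gaussLp hγ (-a) (-d) y) t * gaussChirp (-c) (-e) x t ∂weight γ =
          ∫ t, transform a b c d e γ (gaussChirp (-a) (-d) y) t * gaussChirp (-c) (-e) x t
            ∂weight γ :=
        integral_congr_ae ((hTv y).mul (ae_eq_refl _))
      rw [hy, ← integral_const_mul, integral_transform_mul hγ a b c d e (integrable_gaussChirp hγ _ _ y.2)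
        (integrable_gaussChirp hγ _ _ x.2)]
      refine integral_congr_ae ?_
      filter_upwards [coeFn_gaussLp hγ (-a) (-d) y] with s hs
      rw [hs, hdual]
      ring
    have := congrArg (fun S => S f) hST
    simp only [ContinuousLinearMap.comp_apply, innerSL_apply_apply, smul_apply,
        inner_gaussLp, neg_neg, smul_eq_mul] at this
    rw [this, ← integral_const_mul]
    congr 1 with s
    rw [hdual]
    ring
  intro h h1 h2
  have hh : Integrable h (weight γ) := memLp_one_iff_integrable.1 h1
  -- The integral transform of `h` is bounded but not yet known to be in L²; boundedness is enough
  -- to pair it with Gaussians.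
  have hi (x : ℝ) (hx : 0 < x) :
      Integrable (fun t => transform a b c d e γ h t * gaussChirp (-c) (-e) x t) (weight γ) :=
    (integrable_gaussChirp hγ _ _ hx).bdd_mul (aestronglyMeasurable_transform hγ a b c d e hh)
      (.of_forall (norm_transform_le hγ a b c d e hh))
  have hz : (fun t => T (h2.toLp h) t - transform a b c d e γ h t) =ᵐ[weight γ] 0 := by
    refine ae_eq_zero_of_integral_gaussChirp (-c) (-e) (fun x hx => ?_) fun x hx => ?_
    · simp only [sub_mul]
      exact (integrable_mul_gaussChirp hγ _ _ hx _).sub (hi x hx)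
    · simp only [sub_mul]
      rw [integral_sub (integrable_mul_gaussChirp hγ _ _ hx _) (hi x hx), hT' ⟨x, hx⟩,
        integral_transform_mul hγ a b c d e hh (integrable_gaussChirp hγ _ _ hx), sub_eq_zero]
      refine integral_congr_ae ?_
      filter_upwards [h2.coeFn_toLp] with s hs
      rw [hs]
  filter_upwards [hz] with t ht
  exact sub_eq_zero.1 ht

theorem exists_isExtension {b γ : ℝ} (hb : b ≠ 0) (hγ : -1 / 2 ≤ γ) (a c d e : ℝ) :
    ∃ T, IsExtension a b c d e γ T ∧ ∀ f g, inner ℂ (T f) (T g) = inner ℂ f g := by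
  obtain ⟨T, hT, hi⟩ := exists_inner_preserving_extension (gaussLp hγ (-a) (-d))
    (fun x => gaussFactor b γ x • gaussLp hγ c e (dualParam hb x)) (dense_span_gaussLp hγ _ _)
    (inner_transform_gaussLp hb hγ (-a) c (-d) e)
  exact ⟨T, isExtension_of_map_gaussLp hb hγ hT, hi⟩

/-- Gaussians lie in L¹ ∩ L² and are total with any chirp, in particular with none. -/
theorem IsExtension.unique {a b c d e γ : ℝ} (hγ : -1 / 2 ≤ γ)
    {S T : Lp ℂ 2 (weight γ) →L[ℂ] Lp ℂ 2 (weight γ)} (hS : IsExtension a b c d e γ S)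
    (hT : IsExtension a b c d e γ T) : S = T := by
  refine gaussLp_ext hγ 0 0 fun x => Lp.ext ?_
  have h1 := memLp_one_iff_integrable.2 (integrable_gaussChirp hγ 0 0 x.2)
  exact (hS _ h1 (memLp_gaussChirp hγ 0 0 x.2)).trans (hT _ h1 _).symm

theorem isExtension_transformL2 {b γ : ℝ} (hb : b ≠ 0) (hγ : -1 / 2 ≤ γ) (a c d e : ℝ) :
    IsExtension a b c d e γ (transformL2 a b c d e γ) := by
  have H : ∃ T, IsExtension a b c d e γ T :=
    let ⟨T, hT, _⟩ := exists_isExtension hb hγ a c d e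
    ⟨T, hT⟩
  rw [transformL2, dif_pos H]
  exact H.choose_spec

theorem inner_transformL2 {b γ : ℝ} (hb : b ≠ 0) (hγ : -1 / 2 ≤ γ) (a c d e : ℝ)
    (f g : Lp ℂ 2 (weight γ)) :
    inner ℂ (transformL2 a b c d e γ f) (transformL2 a b c d e γ g) = inner ℂ f g := by
  obtain ⟨T, hT, hi⟩ := exists_isExtension hb hγ a c d e
  -- The operator picked by choice is not by construction the one that preserves inner products;
  -- uniqueness identifies them.
  rw [(isExtension_transformL2 hb hγ a c d e).unique hγ hT, hi]

theorem inner_eq_setIntegral (γ : ℝ) (f g : Lp ℂ 2 (weight γ)) :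
    inner ℂ g f = ∫ s in Ioi (0 : ℝ), f s * conj (g s) * ((s ^ (2 * γ + 1) : ℝ) : ℂ) := by
  rw [L2.inner_def, ← integral_weight_complex]
  rfl

end QPFB

/-- Parseval's formula for the quadratic-phase Fourier–Bessel transform. The first two conjuncts say
that the transform on `L²_γ(ℝ₊)` is well defined: it is the one and only bounded operator that
extends the integral transform. -/
theorem mainTheorem3 (a b c d e γ : ℝ) (hb : b ≠ 0) (hγ : -1 / 2 ≤ γ) :
    QPFB.IsExtension a b c d e γ (QPFB.transformL2 a b c d e γ) ∧
    (∀ T : Lp ℂ 2 (QPFB.weight γ) →L[ℂ] Lp ℂ 2 (QPFB.weight γ),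
      QPFB.IsExtension a b c d e γ T → T = QPFB.transformL2 a b c d e γ) ∧
    ∀ (h g : ℝ → ℂ) (hh : MemLp h 2 (QPFB.weight γ)) (hg : MemLp g 2 (QPFB.weight γ)),
      ∫ s in Ioi (0 : ℝ), h s * conj (g s) * ((s ^ (2 * γ + 1) : ℝ) : ℂ) =
        ∫ t in Ioi (0 : ℝ), QPFB.transformL2 a b c d e γ (hh.toLp h) t *
          conj (QPFB.transformL2 a b c d e γ (hg.toLp g) t) * ((t ^ (2 * γ + 1) : ℝ) : ℂ) := by
  refine ⟨QPFB.isExtension_transformL2 hb hγ a c d e,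
    fun T hT => hT.unique hγ (QPFB.isExtension_transformL2 hb hγ a c d e), fun h g hh hg => ?_⟩
  rw [← QPFB.inner_eq_setIntegral, QPFB.inner_transformL2 hb hγ, L2.inner_def,
    ← QPFB.integral_weight_complex γ fun s => h s * conj (g s)]
  refine integral_congr_ae ?_
  filter_upwards [hh.coeFn_toLp, hg.coeFn_toLp] with s h1 h2
  rw [h1, h2, RCLike.inner_apply]
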